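/- Let $\kappa>0$ and $r=1/\kappa$. For $x,y\in\mathbb R^2$ let $\Sigma(x,y)$ be the space of $\kappa$-constrained plane curves from $x$ to $y$: arc-length parametrised curves $\sigma:[0,s]\to\mathbb R^2$ (of some length $s>0$) with $\sigma(0)=x$ and $\sigma(s)=y$ that are $C^1$, piecewise $C^2$, and satisfy $\|\sigma''(t)\|\le\kappa$ for every $t\in[0,s]$ at which $\sigma''(t)$ is defined. Equip $\Sigma(x,y)$ with the $C^1$ metric, curves of different lengths being compared after rescaling their domains to $[0,1]$. Two curves $\sigma,\gamma\in\Sigma(x,y)$ are $\kappa$-constrained homotopic if there is a continuous map $H:[0,1]\to\Sigma(x,y)$ with $H(0)=\sigma$ and $H(1)=\gamma$; a homotopy class is an equivalence class of this relation. Suppose that $d=\|x-y\|$ satisfies $0<d<2r$. Let $D_1,D_2$ be the closed disks of radius $r$ whose boundary circles $C_1,C_2$ satisfy $C_1\cap C_2=\{x,y\}$, let $\mathcal I=\mathrm{int}(D_1\cap D_2)$; its boundary $\partial(\mathcal I)$ is the union of the shorter arcs of $C_1$ and of $C_2$ joining $x$ and $y$. Then each of these two arcs is the image of a curve in $\Sigma(x,y)$,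 and no curve in $\Sigma(x,y)$ whose image is one of these two arcs is $\kappa$-constrained homotopic to a curve $\gamma\in\Sigma(x,y)$ that is not in $\mathrm{cl}(\mathcal I)$, i.e. such that $\gamma(t)\notin\mathrm{cl}(\mathcal I)$ for some $t$. Consequently $\Sigma(x,y)$ has at least two homotopy classes. -/

import Mathlib

open Set

noncomputable section

/-- The Euclidean plane. -/
abbrev Plane : Type := EuclideanSpace ℝ (Fin 2)

/-- `σ` is piecewise `C²` on `[0, s]`: there is a partition `0 = t₀ < t₁ < … < t_m = s` such that
`σ` is `C²` on each closed piece `[tᵢ, tᵢ₊₁]` (one-sided derivatives at the end points). -/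
def IsPiecewiseC2 (σ : ℝ → Plane) (s : ℝ) : Prop :=
  ∃ (m : ℕ) (t : ℕ → ℝ), StrictMonoOn t (Iic m) ∧ t 0 = 0 ∧ t m = s ∧
    ∀ i < m, ContDiffOn ℝ 2 σ (Icc (t i) (t (i + 1)))

/-- The space `Σ(x, y)` of `κ`-constrained plane curves from `x` to `y`: arc-length parametrised
curves `[0, len] → ℝ²` which are `C¹`, piecewise `C²`, and satisfy `‖σ''(t)‖ ≤ κ` wherever `σ''(t)`
is defined. Only the values of `toFun` on `[0, len]` are meaningful. -/
structure ConstrainedCurve (κ : ℝ) (x y : Plane) where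
  /-- the length of the curve -/
  len : ℝ
  /-- the arc-length parametrisation -/
  toFun : ℝ → Plane
  len_pos : 0 < len
  contDiffOn : ContDiffOn ℝ 1 toFun (Icc 0 len)
  piecewiseC2 : IsPiecewiseC2 toFun len
  unit_speed : ∀ t ∈ Icc 0 len, ‖derivWithin toFun (Icc 0 len) t‖ = 1
  curvature_le : ∀ t ∈ Icc 0 len, ∀ a : Plane,
    HasDerivWithinAt (derivWithin toFun (Icc 0 len)) a (Icc 0 len) t → ‖a‖ ≤ κ
  source : toFun 0 = x
  target : toFun len = y

namespace ConstrainedCurve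

variable {κ : ℝ} {x y : Plane}

theorem mul_mem_Icc (σ : ConstrainedCurve κ x y) (u : unitInterval) :
    σ.len * (u : ℝ) ∈ Icc 0 σ.len :=
  ⟨mul_nonneg σ.len_pos.le u.2.1, mul_le_of_le_one_right σ.len_pos.le u.2.2⟩

/-- The curve rescaled to the unit interval, `u ↦ σ(len · u)`. -/
def rescaled (σ : ConstrainedCurve κ x y) : C(unitInterval, Plane) where
  toFun u := σ.toFun (σ.len * (u : ℝ))
  continuous_toFun :=
    σ.contDiffOn.continuousOn.comp_continuous (by fun_prop) σ.mul_mem_Icc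

/-- The velocity of the rescaled curve, `u ↦ len · σ'(len · u)`. -/
def rescaledVelocity (σ : ConstrainedCurve κ x y) : C(unitInterval, Plane) where
  toFun u := σ.len • derivWithin σ.toFun (Icc 0 σ.len) (σ.len * (u : ℝ))
  continuous_toFun :=
    ((σ.contDiffOn.continuousOn_derivWithin (uniqueDiffOn_Icc σ.len_pos) le_rfl).comp_continuous
      (by fun_prop) σ.mul_mem_Icc).const_smul σ.len

/-- The `C¹` metric on `Σ(x, y)`: the distance of two curves is the larger of the sup-distance of
the curves and the sup-distance of their velocities, both rescaled to `[0, 1]`. (Two curves are at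
distance `0` exactly when they have the same length `len` and agree on `[0, len]`.) -/
instance : PseudoMetricSpace (ConstrainedCurve κ x y) :=
  PseudoMetricSpace.induced (fun σ => (σ.rescaled, σ.rescaledVelocity)) inferInstance

/-- The image of the curve in the plane. -/
def image (σ : ConstrainedCurve κ x y) : Set Plane := σ.toFun '' Icc 0 σ.len

/-- The curve is *in* `X`. -/
def IsIn (σ : ConstrainedCurve κ x y) (X : Set Plane) : Prop :=
  ∀ t ∈ Icc 0 σ.len, σ.toFun t ∈ X

/-- The curve is *not in* `X`: some point of it lies outside `X`. -/
def IsNotIn (σ : ConstrainedCurve κ x y) (X : Set Plane) : Prop :=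
  ∃ t ∈ Icc 0 σ.len, σ.toFun t ∉ X

/-- Two curves are `κ`-constrained homotopic if there is a continuous map
`H : [0, 1] → Σ(x, y)` with `H(0) = σ` and `H(1) = γ`. -/
def Homotopic (σ γ : ConstrainedCurve κ x y) : Prop := Joined σ γ

end ConstrainedCurve

/-- The set of `κ`-constrained homotopy classes in `Σ(x, y)`, that is, the quotient of `Σ(x, y)` by
the relation of being joined by a continuous path in `Σ(x, y)`. -/
abbrev HomotopyClasses (κ : ℝ) (x y : Plane) : Type := ZerothHomotopy (ConstrainedCurve κ x y)

/-- The open lens `int (D₁ ∩ D₂)`, where `Dᵢ` is the closed disk with centre `cᵢ` and radius `r`. -/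
def lens (r : ℝ) (c₁ c₂ : Plane) : Set Plane :=
  interior (Metric.closedBall c₁ r ∩ Metric.closedBall c₂ r)

/-- The shorter arc joining two non-antipodal points `x`, `y` of the circle with centre `c` and
radius `r`: the part of the circle in the convex cone with apex `c` spanned by `x` and `y`. -/
def shorterArc (r : ℝ) (c x y : Plane) : Set Plane :=
  {z ∈ Metric.sphere c r | ∃ a b : ℝ, 0 ≤ a ∧ 0 ≤ b ∧ z - c = a • (x - c) + b • (y - c)}

end

open Filter Topology
open scoped RealInnerProductSpace

/-! Let `e` be the unit vector from `x` to `y`, and call a curve forward if its velocity always has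
positive inner product with `e`. The forward curves form a clopen subset of `Σ(x, y)`, so a homotopy
can neither enter nor leave it. Openness is compactness of `[0, 1]` in the `C¹` metric. A limit of
forward curves only satisfies the weak inequality, so closedness needs rigidity: since `d < 2r`, a
curve satisfying the weak inequality satisfies the strict one (`fst_velocity_pos`).

Rigidity comes from comparison with circles of radius `r`. If the velocity were perpendicular to `e`
at some time, the curvature bound would keep the curve from turning back fast enough: its heights
before and after that time would make the total rise positive, while both ends lie at height `0`.
The same comparison, with the circles through `x` and `y`, traps every forward curve in both disks
(`snd_add_le`), hence in `cl(I)`.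

Any curve tracing a shorter arc is forward, so it is not homotopic to a curve leaving `cl(I)`. The
longer arc of `C₁` starts out backwards and provides a second class. -/

/-! ### Comparison with circular graphs of radius `r` -/

/-- In the closed right half-plane the height of a unit vector increases with its angle. Applied to
`(a, b)` and `(w, -q) / r`, the hypothesis `h` orders the angles, and `b * w + q * a` is the
resulting nonnegative cross product. -/
theorem nonneg_add_mul_div {r a b q w : ℝ} (hr : 0 < r) (ha : 0 ≤ a) (hab : a ^ 2 + b ^ 2 = 1)
    (hw : 0 < w) (hwq : w ^ 2 + q ^ 2 = r ^ 2) (h : 0 ≤ b + q / r) : 0 ≤ b + q * a / w := by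
  have h1 : 0 ≤ b * r + q := by
    have := mul_nonneg h hr.le
    rwa [add_mul, div_mul_cancel₀ _ hr.ne'] at this
  have h2 : 0 ≤ b * w + q * a := by
    by_contra! hlt
    rcases le_or_gt 0 b with hb | hb <;> rcases le_or_gt 0 q with hq | hq
    · nlinarith [mul_nonneg hb hw.le, mul_nonneg hq ha]
    · have h3 : q ^ 2 ≤ (b * r) ^ 2 := by nlinarith
      have h4 : (b * w) ^ 2 < (q * a) ^ 2 := by
        have : 0 ≤ b * w := mul_nonneg hb hw.le
        nlinarith
      have e1 : w ^ 2 = r ^ 2 - q ^ 2 := by linarith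
      have e2 : a ^ 2 = 1 - b ^ 2 := by linarith
      rw [mul_pow, mul_pow, e1, e2] at h4
      nlinarith
    · have h3 : (b * r) ^ 2 ≤ q ^ 2 := by nlinarith [mul_pos (neg_pos.2 hb) hr]
      have h4 : (q * a) ^ 2 < (b * w) ^ 2 := by
        have : 0 ≤ q * a := mul_nonneg hq ha
        nlinarith
      have e1 : w ^ 2 = r ^ 2 - q ^ 2 := by linarith
      have e2 : a ^ 2 = 1 - b ^ 2 := by linarith
      rw [mul_pow, mul_pow, e1, e2] at h4
      nlinarith
    · nlinarith [mul_pos (neg_pos.2 hb) hr]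
  have : b + q * a / w = (b * w + q * a) / w := by field_simp
  rw [this]
  exact div_nonneg h2 hw.le

section Comparison

variable {r p t₀ t₁ : ℝ} {E N a b : ℝ → ℝ}

theorem hasDerivWithinAt_sub_sqrt {D : Set ℝ} {t : ℝ} (hE : HasDerivWithinAt E (a t) D t)
    (hN : HasDerivWithinAt N (b t) D t) (hp : 0 < r ^ 2 - (E t - p) ^ 2) :
    HasDerivWithinAt (fun t => N t - √(r ^ 2 - (E t - p) ^ 2))
      (b t + (E t - p) * a t / √(r ^ 2 - (E t - p) ^ 2)) D t := by
  have h1 := (((hE.sub_const p).pow 2).const_sub (r ^ 2)).sqrt hp.ne'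
  refine (hN.sub h1).congr_deriv ?_
  have := (Real.sqrt_pos.2 hp).ne'
  simp only [Pi.pow_apply]
  field_simp
  ring

theorem sq_sub_sq_pos_of_abs_lt {q : ℝ} (h : |q| < r) : 0 < r ^ 2 - q ^ 2 := by
  have := sq_lt_sq' (abs_lt.1 h).1 (abs_lt.1 h).2
  linarith

/-- The curve climbs relative to the upper semicircle centred at abscissa `p`: `hg` says that its
direction is at least as steep as the semicircle's tangent at the same abscissa. The strict bound
`hp` keeps the square root differentiable. -/
theorem monotoneOn_sub_sqrt (hr : 0 < r)
    (hE : ∀ t ∈ Icc t₀ t₁, HasDerivWithinAt E (a t) (Icc t₀ t₁) t)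
    (hN : ∀ t ∈ Icc t₀ t₁, HasDerivWithinAt N (b t) (Icc t₀ t₁) t)
    (ha : ∀ t ∈ Icc t₀ t₁, 0 ≤ a t) (hab : ∀ t ∈ Icc t₀ t₁, a t ^ 2 + b t ^ 2 = 1)
    (hp : ∀ t ∈ Icc t₀ t₁, |E t - p| < r) (hg : ∀ t ∈ Icc t₀ t₁, 0 ≤ b t + (E t - p) / r) :
    MonotoneOn (fun t => N t - √(r ^ 2 - (E t - p) ^ 2)) (Icc t₀ t₁) := by
  have hD := fun t ht => hasDerivWithinAt_sub_sqrt (hE t ht) (hN t ht)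
    (sq_sub_sq_pos_of_abs_lt (hp t ht))
  refine monotoneOn_of_hasDerivWithinAt_nonneg (convex_Icc _ _)
    (fun t ht => (hD t ht).continuousWithinAt)
    (fun t ht => (hD t (interior_subset ht)).mono interior_subset) fun t ht => ?_
  have ht' := interior_subset ht
  have hpos := sq_sub_sq_pos_of_abs_lt (hp t ht')
  refine nonneg_add_mul_div hr (ha t ht') (hab t ht') (Real.sqrt_pos.2 hpos) ?_ (hg t ht')
  rw [Real.sq_sqrt hpos.le]
  ring

theorem antitoneOn_sub_sqrt (hr : 0 < r)
    (hE : ∀ t ∈ Icc t₀ t₁, HasDerivWithinAt E (a t) (Icc t₀ t₁) t)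
    (hN : ∀ t ∈ Icc t₀ t₁, HasDerivWithinAt N (b t) (Icc t₀ t₁) t)
    (ha : ∀ t ∈ Icc t₀ t₁, 0 ≤ a t) (hab : ∀ t ∈ Icc t₀ t₁, a t ^ 2 + b t ^ 2 = 1)
    (hp : ∀ t ∈ Icc t₀ t₁, |E t - p| < r) (hg : ∀ t ∈ Icc t₀ t₁, b t + (E t - p) / r ≤ 0) :
    AntitoneOn (fun t => N t - √(r ^ 2 - (E t - p) ^ 2)) (Icc t₀ t₁) := by
  have hD := fun t ht => hasDerivWithinAt_sub_sqrt (hE t ht) (hN t ht)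
    (sq_sub_sq_pos_of_abs_lt (hp t ht))
  refine antitoneOn_of_hasDerivWithinAt_nonpos (convex_Icc _ _)
    (fun t ht => (hD t ht).continuousWithinAt)
    (fun t ht => (hD t (interior_subset ht)).mono interior_subset) fun t ht => ?_
  have ht' := interior_subset ht
  have hpos := sq_sub_sq_pos_of_abs_lt (hp t ht')
  have := nonneg_add_mul_div (b := -b t) (q := -(E t - p)) hr (ha t ht')
    (by rw [neg_sq]; exact hab t ht') (Real.sqrt_pos.2 hpos)
    (by rw [Real.sq_sqrt hpos.le]; ring) (by rw [neg_div]; linarith [hg t ht'])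
  rw [neg_mul, neg_div] at this
  linarith

end Comparison

/-! ### Forward curves in coordinates -/

/-- The coordinates `(E, N)` of a unit-speed curve on `[0, s]` from `(-δ, 0)` to `(δ, 0)` with
velocity `(a, b)`, never moving backwards (`0 ≤ a`) and with curvature at most `1 / r`; the
curvature bound enters through the monotonicity of `E / r ± b`. -/
structure IsForwardProfile (r δ s : ℝ) (E N a b : ℝ → ℝ) : Prop where
  length_nonneg : 0 ≤ s
  deriv_fst : ∀ t ∈ Icc 0 s, HasDerivWithinAt E (a t) (Icc 0 s) t
  deriv_snd : ∀ t ∈ Icc 0 s, HasDerivWithinAt N (b t) (Icc 0 s) t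
  unit : ∀ t ∈ Icc 0 s, a t ^ 2 + b t ^ 2 = 1
  forward : ∀ t ∈ Icc 0 s, 0 ≤ a t
  mono_add : MonotoneOn (fun t => E t / r + b t) (Icc 0 s)
  mono_sub : MonotoneOn (fun t => E t / r - b t) (Icc 0 s)
  fst_zero : E 0 = -δ
  fst_end : E s = δ
  snd_zero : N 0 = 0
  snd_end : N s = 0

namespace IsForwardProfile

variable {r δ s : ℝ} {E N a b : ℝ → ℝ}

/-- Reflection in the chord turns upper bounds into lower bounds and swaps the two monotonicity
conditions. -/
theorem reflect (h : IsForwardProfile r δ s E N a b) :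
    IsForwardProfile r δ s E (fun t => -N t) a (fun t => -b t) where
  length_nonneg := h.length_nonneg
  deriv_fst := h.deriv_fst
  deriv_snd t ht := (h.deriv_snd t ht).neg
  unit t ht := by rw [neg_sq]; exact h.unit t ht
  forward := h.forward
  mono_add := by simpa only [← sub_eq_add_neg] using h.mono_sub
  mono_sub := by simpa only [sub_neg_eq_add] using h.mono_add
  fst_zero := h.fst_zero
  fst_end := h.fst_end
  snd_zero := by simp [h.snd_zero]
  snd_end := by simp [h.snd_end]

theorem monotoneOn_fst (h : IsForwardProfile r δ s E N a b) : MonotoneOn E (Icc 0 s) :=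
  monotoneOn_of_hasDerivWithinAt_nonneg (convex_Icc _ _)
    (fun t ht => (h.deriv_fst t ht).continuousWithinAt)
    (fun t ht => (h.deriv_fst t (interior_subset ht)).mono interior_subset)
    fun t ht => h.forward t (interior_subset ht)

theorem fst_mem (h : IsForwardProfile r δ s E N a b) {t : ℝ} (ht : t ∈ Icc 0 s) :
    E t ∈ Icc (-δ) δ :=
  ⟨h.fst_zero ▸ h.monotoneOn_fst ⟨le_rfl, h.length_nonneg⟩ ht ht.1,
    h.fst_end ▸ h.monotoneOn_fst ht ⟨h.length_nonneg, le_rfl⟩ ht.2⟩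

/-- The comparison circle passes through both ends of the curve. As `E / r + b` is monotone, its
sign at `t` persists on one side of `t`: if nonnegative, comparison runs forward to the end; if
nonpositive, back to the start. At either end the bound is an equality. -/
theorem snd_add_le (h : IsForwardProfile r δ s E N a b) (hr : 0 < r) (hδ : δ < r) {t : ℝ}
    (ht : t ∈ Icc 0 s) : N t + √(r ^ 2 - δ ^ 2) ≤ √(r ^ 2 - E t ^ 2) := by
  have habs : ∀ u ∈ Icc 0 s, |E u - 0| < r := fun u hu => by
    have := h.fst_mem hu
    rw [sub_zero, abs_lt]
    exact ⟨by linarith [this.1], by linarith [this.2]⟩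
  rcases le_total 0 (b t + (E t - 0) / r) with hg | hg
  · have hsub : Icc t s ⊆ Icc 0 s := Icc_subset_Icc_left ht.1
    have := monotoneOn_sub_sqrt (p := 0) hr
      (fun u hu => (h.deriv_fst u (hsub hu)).mono hsub)
      (fun u hu => (h.deriv_snd u (hsub hu)).mono hsub)
      (fun u hu => h.forward u (hsub hu)) (fun u hu => h.unit u (hsub hu))
      (fun u hu => habs u (hsub hu))
      (fun u hu => by
        have := h.mono_add ht (hsub hu) hu.1
        simp only [sub_zero] at *
        linarith) ⟨le_rfl, ht.2⟩ ⟨ht.2, le_rfl⟩ ht.2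
    simp only [sub_zero, h.snd_end, h.fst_end] at this
    linarith
  · have hsub : Icc 0 t ⊆ Icc 0 s := Icc_subset_Icc_right ht.2
    have := antitoneOn_sub_sqrt (p := 0) hr
      (fun u hu => (h.deriv_fst u (hsub hu)).mono hsub)
      (fun u hu => (h.deriv_snd u (hsub hu)).mono hsub)
      (fun u hu => h.forward u (hsub hu)) (fun u hu => h.unit u (hsub hu))
      (fun u hu => habs u (hsub hu))
      (fun u hu => by
        have := h.mono_add (hsub hu) ht hu.2
        simp only [sub_zero] at *
        linarith) ⟨le_rfl, ht.1⟩ ⟨ht.1, le_rfl⟩ ht.1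
    simp only [sub_zero, h.snd_zero, h.fst_zero, neg_sq] at this
    linarith

/-- After a vertical upward tangent at `t`, the sharpest right turn follows the circle centred at
abscissa `E t + r`, whose graph has a vertical tangent at `E t`. Moving the centre to `E t + r * β`
with `β < 1` avoids this singularity; `hβδ` keeps the far end within the graph. -/
theorem sqrt_le_snd_end_sub (h : IsForwardProfile r δ s E N a b) (hr : 0 < r) {β t : ℝ}
    (hβ : β < 1) (hβδ : 2 * δ < r * (1 + β)) (ht : t ∈ Icc 0 s) (hb : b t = 1) :
    √(r ^ 2 - (δ - (E t + r * β)) ^ 2) - √(r ^ 2 - (r * β) ^ 2) ≤ -N t := by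
  have hsub : Icc t s ⊆ Icc 0 s := Icc_subset_Icc_left ht.1
  have hm := h.fst_mem ht
  have := monotoneOn_sub_sqrt (p := E t + r * β) hr
    (fun u hu => (h.deriv_fst u (hsub hu)).mono hsub)
    (fun u hu => (h.deriv_snd u (hsub hu)).mono hsub)
    (fun u hu => h.forward u (hsub hu)) (fun u hu => h.unit u (hsub hu))
    (fun u hu => by
      have h1 := h.monotoneOn_fst ht (hsub hu) hu.1
      have h2 := h.fst_mem (hsub hu)
      have h3 : r * β < r * 1 := mul_lt_mul_of_pos_left hβ hr
      rw [abs_lt]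
      exact ⟨by linarith, by linarith [h2.2, hm.1]⟩)
    (fun u hu => by
      have := h.mono_add ht (hsub hu) hu.1
      have e : (E u - (E t + r * β)) / r = E u / r - E t / r - β := by field_simp; ring
      simp only at this
      rw [e]
      linarith) ⟨le_rfl, ht.2⟩ ⟨ht.2, le_rfl⟩ ht.2
  simp only [h.snd_end, h.fst_end, sub_add_cancel_left, neg_sq] at this
  linarith

theorem sqrt_le_snd_sub_zero (h : IsForwardProfile r δ s E N a b) (hr : 0 < r) {β t : ℝ}
    (hβ : β < 1) (hβδ : 2 * δ < r * (1 + β)) (ht : t ∈ Icc 0 s) (hb : b t = 1) :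
    √(r ^ 2 - (-δ - (E t - r * β)) ^ 2) - √(r ^ 2 - (r * β) ^ 2) ≤ N t := by
  have hsub : Icc 0 t ⊆ Icc 0 s := Icc_subset_Icc_right ht.2
  have hm := h.fst_mem ht
  have := antitoneOn_sub_sqrt (p := E t - r * β) hr
    (fun u hu => (h.deriv_fst u (hsub hu)).mono hsub)
    (fun u hu => (h.reflect.deriv_snd u (hsub hu)).mono hsub)
    (fun u hu => h.forward u (hsub hu)) (fun u hu => h.reflect.unit u (hsub hu))
    (fun u hu => by
      have h1 := h.monotoneOn_fst (hsub hu) ht hu.2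
      have h2 := h.fst_mem (hsub hu)
      have h3 : r * β < r * 1 := mul_lt_mul_of_pos_left hβ hr
      rw [abs_lt]
      exact ⟨by linarith [h2.1, hm.2], by linarith⟩)
    (fun u hu => by
      have := h.mono_sub (hsub hu) ht hu.2
      have e : (E u - (E t - r * β)) / r = E u / r - E t / r + β := by field_simp; ring
      simp only at this
      rw [e]
      linarith) ⟨le_rfl, ht.1⟩ ⟨ht.1, le_rfl⟩ ht.1
  simp only [h.snd_zero, h.fst_zero, neg_zero, sub_sub_cancel] at this
  linarith

/-- The rises before and after `t` add up to zero, but each is bounded below by the height of a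
quarter-circle graph above its lowest point, and these two bounds cannot both vanish. -/
theorem snd_velocity_ne_one (h : IsForwardProfile r δ s E N a b) (hδ0 : 0 < δ)
    (hδ : δ < r) {t : ℝ} (ht : t ∈ Icc 0 s) : b t ≠ 1 := by
  intro hb
  have hr : 0 < r := hδ0.trans hδ
  have hm := h.fst_mem ht
  -- Adding the two estimates cancels `N t`; continuity then allows `β` to tend to `1` from below.
  have hlim : √(r ^ 2 - (δ - (E t + r * 1)) ^ 2) - √(r ^ 2 - (r * 1) ^ 2) +
      (√(r ^ 2 - (-δ - (E t - r * 1)) ^ 2) - √(r ^ 2 - (r * 1) ^ 2)) ≤ 0 := by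
    have hc : Continuous fun β : ℝ => √(r ^ 2 - (δ - (E t + r * β)) ^ 2) - √(r ^ 2 - (r * β) ^ 2) +
      (√(r ^ 2 - (-δ - (E t - r * β)) ^ 2) - √(r ^ 2 - (r * β) ^ 2)) := by fun_prop
    refine le_of_tendsto ((hc.tendsto 1).mono_left (nhdsWithin_le_nhds (s := Iio 1))) ?_
    have h1 : ∀ᶠ β in 𝓝 (1 : ℝ), 2 * δ < r * (1 + β) :=
      (continuous_const.tendsto _).eventually_lt
        (Continuous.tendsto (by fun_prop : Continuous fun β : ℝ => r * (1 + β)) 1) (by linarith)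
    filter_upwards [self_mem_nhdsWithin, nhdsWithin_le_nhds h1] with β hβ h1
    have := h.sqrt_le_snd_end_sub hr hβ h1 ht hb
    have := h.sqrt_le_snd_sub_zero hr hβ h1 ht hb
    linarith
  rw [mul_one, sub_self, Real.sqrt_zero, sub_zero, sub_zero] at hlim
  have e1 : r ^ 2 - (δ - (E t + r)) ^ 2 = (δ - E t) * (2 * r - (δ - E t)) := by ring
  have e2 : r ^ 2 - (-δ - (E t - r)) ^ 2 = (δ + E t) * (2 * r - (δ + E t)) := by ring
  have n1 := Real.sqrt_nonneg (r ^ 2 - (δ - (E t + r)) ^ 2)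
  have n2 := Real.sqrt_nonneg (r ^ 2 - (-δ - (E t - r)) ^ 2)
  -- Both radicands are now nonpositive. By the factorisations and `2 * δ < 2 * r`, this would force
  -- `E t = δ` and `E t = -δ` at once.
  have z1 := Real.sqrt_eq_zero'.1 (le_antisymm (by linarith) n1)
  have z2 := Real.sqrt_eq_zero'.1 (le_antisymm (by linarith) n2)
  rw [e1] at z1
  rw [e2] at z2
  rcases lt_or_ge (E t) δ with hlt | hge
  · exact z1.not_gt (mul_pos (by linarith) (by linarith [hm.1]))
  · exact z2.not_gt (mul_pos (by linarith) (by linarith [hm.2]))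

theorem fst_velocity_pos (h : IsForwardProfile r δ s E N a b) (hδ0 : 0 < δ)
    (hδ : δ < r) {t : ℝ} (ht : t ∈ Icc 0 s) : 0 < a t := by
  refine (h.forward t ht).lt_of_ne' fun ha => ?_
  have hu := h.unit t ht
  rw [ha, zero_pow two_ne_zero, zero_add, sq, mul_self_eq_one_iff] at hu
  rcases hu with hb | hb
  · exact h.snd_velocity_ne_one hδ0 hδ ht hb
  · exact h.reflect.snd_velocity_ne_one hδ0 hδ ht (by simp [hb])

end IsForwardProfile

/-! ### From the curvature bound to coordinate profiles -/

theorem monotoneOn_Icc_of_piecewise {f : ℝ → ℝ} {m : ℕ} {t : ℕ → ℝ} (ht : StrictMonoOn t (Iic m))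
    (hf : ContinuousOn f (Icc (t 0) (t m)))
    (hd : ∀ i < m, ∀ u ∈ Ioo (t i) (t (i + 1)), ∃ f', HasDerivAt f f' u ∧ 0 ≤ f') :
    MonotoneOn f (Icc (t 0) (t m)) := by
  have hmono : ∀ i j, i ≤ j → j ≤ m → t i ≤ t j := fun i j hij hj =>
    ht.monotoneOn (hij.trans hj) hj hij
  suffices ∀ k ≤ m, MonotoneOn f (Icc (t 0) (t k)) from this m le_rfl
  intro k
  induction k with
  | zero => intro _; simp
  | succ k ih =>
    intro hk
    have h0 := hmono 0 k k.zero_le (by omega)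
    have h1 := hmono k (k + 1) k.le_succ hk
    rw [← Icc_union_Icc_eq_Icc h0 h1]
    refine (ih (by omega)).union_right ?_ (isGreatest_Icc h0) (isLeast_Icc h1)
    refine monotoneOn_of_deriv_nonneg (convex_Icc _ _)
      (hf.mono (Icc_subset_Icc h0 (hmono _ _ hk le_rfl))) (fun u hu => ?_) fun u hu => ?_ <;>
    · rw [interior_Icc] at hu
      obtain ⟨f', hf', h⟩ := hd k hk u hu
      first
        | exact hf'.differentiableAt.differentiableWithinAt
        | rwa [hf'.deriv]

/-- The components `(p, q)` of a vector orthogonal to the unit vector `(a, b)`. -/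
theorem abs_le_mul_of_orthogonal {a b p q κ : ℝ} (ha : 0 ≤ a) (hκ : 0 ≤ κ)
    (hab : a ^ 2 + b ^ 2 = 1) (horth : a * p + b * q = 0) (hpq : p ^ 2 + q ^ 2 ≤ κ ^ 2) :
    |q| ≤ κ * a := by
  refine abs_le_of_sq_le_sq ?_ (mul_nonneg hκ ha)
  have h1 : q ^ 2 = a ^ 2 * (p ^ 2 + q ^ 2) := by
    have h2 : (b * q) ^ 2 = (a * p) ^ 2 := by
      rw [show b * q = -(a * p) by linarith, neg_sq]
    linear_combination h2 - q ^ 2 * hab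
  rw [h1, mul_pow, mul_comm]
  exact mul_le_mul_of_nonneg_right hpq (sq_nonneg a)

namespace OrthonormalBasis

theorem inner_eq_fin_two (B : OrthonormalBasis (Fin 2) ℝ Plane) (v w : Plane) :
    ⟪v, w⟫ = ⟪B 0, v⟫ * ⟪B 0, w⟫ + ⟪B 1, v⟫ * ⟪B 1, w⟫ := by
  rw [← B.sum_inner_mul_inner, Fin.sum_univ_two, real_inner_comm (B 0), real_inner_comm (B 1)]

theorem norm_sq_eq_fin_two (B : OrthonormalBasis (Fin 2) ℝ Plane) (v : Plane) :
    ‖v‖ ^ 2 = ⟪B 0, v⟫ ^ 2 + ⟪B 1, v⟫ ^ 2 := by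
  rw [← real_inner_self_eq_norm_sq, B.inner_eq_fin_two, sq, sq]

@[simp] theorem inner_zero_zero (B : OrthonormalBasis (Fin 2) ℝ Plane) : ⟪B 0, B 0⟫ = 1 := by
  simp

@[simp] theorem inner_one_one (B : OrthonormalBasis (Fin 2) ℝ Plane) : ⟪B 1, B 1⟫ = 1 := by
  simp

@[simp] theorem inner_zero_one (B : OrthonormalBasis (Fin 2) ℝ Plane) : ⟪B 0, B 1⟫ = 0 :=
  B.orthonormal.2 (by simp)

@[simp] theorem inner_one_zero (B : OrthonormalBasis (Fin 2) ℝ Plane) : ⟪B 1, B 0⟫ = 0 :=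
  B.orthonormal.2 (by simp)

theorem eq_of_inner_eq {B : OrthonormalBasis (Fin 2) ℝ Plane} {v w : Plane}
    (h0 : ⟪B 0, v⟫ = ⟪B 0, w⟫) (h1 : ⟪B 1, v⟫ = ⟪B 1, w⟫) : v = w := by
  rw [← B.sum_repr' v, ← B.sum_repr' w, Fin.sum_univ_two, Fin.sum_univ_two, h0, h1]

end OrthonormalBasis

namespace ConstrainedCurve

variable {κ : ℝ} {x y : Plane} (σ : ConstrainedCurve κ x y)

/-- The velocity of a curve, with respect to arc length. -/
noncomputable def velocity (t : ℝ) : Plane := derivWithin σ.toFun (Icc 0 σ.len) t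

theorem hasDerivWithinAt {t : ℝ} (ht : t ∈ Icc 0 σ.len) :
    HasDerivWithinAt σ.toFun (σ.velocity t) (Icc 0 σ.len) t :=
  (σ.contDiffOn.differentiableOn one_ne_zero t ht).hasDerivWithinAt

theorem continuousOn_velocity : ContinuousOn σ.velocity (Icc 0 σ.len) :=
  σ.contDiffOn.continuousOn_derivWithin (uniqueDiffOn_Icc σ.len_pos) le_rfl

theorem norm_velocity {t : ℝ} (ht : t ∈ Icc 0 σ.len) : ‖σ.velocity t‖ = 1 := σ.unit_speed t ht

theorem hasDerivWithinAt_inner (v p : Plane) {t : ℝ} (ht : t ∈ Icc 0 σ.len) :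
    HasDerivWithinAt (fun t => ⟪v, σ.toFun t - p⟫) ⟪v, σ.velocity t⟫ (Icc 0 σ.len) t := by
  simpa using (hasDerivWithinAt_const t (Icc 0 σ.len) v).inner ℝ
    ((σ.hasDerivWithinAt ht).sub_const p)

/-- Orthogonality comes from differentiating the constant `‖σ'‖ ^ 2 = 1`. -/
theorem exists_hasDerivAt_velocity {u v t : ℝ} (huv : Icc u v ⊆ Icc 0 σ.len)
    (hc : ContDiffOn ℝ 2 σ.toFun (Icc u v)) (ht : t ∈ Ioo u v) :
    ∃ A, HasDerivAt σ.velocity A t ∧ ‖A‖ ≤ κ ∧ ⟪σ.velocity t, A⟫ = 0 := by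
  have hmem : t ∈ Icc 0 σ.len := huv (Ioo_subset_Icc_self ht)
  have hev : ∀ᶠ z in 𝓝 t, z ∈ Ioo u v := isOpen_Ioo.mem_nhds ht
  have hI : ∀ᶠ z in 𝓝 t, Icc 0 σ.len ∈ 𝓝 z := by
    filter_upwards [hev] with z hz
    exact mem_of_superset (isOpen_Ioo.mem_nhds hz) (Ioo_subset_Icc_self.trans huv)
  have heq : σ.velocity =ᶠ[𝓝 t] deriv σ.toFun := by
    filter_upwards [hI] with z hz
    exact derivWithin_of_mem_nhds hz
  have hd : DifferentiableAt ℝ (deriv σ.toFun) t :=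
    (((hc.mono Ioo_subset_Icc_self).deriv_of_isOpen (m := 1) isOpen_Ioo
      (by norm_num)).differentiableOn one_ne_zero).differentiableAt (isOpen_Ioo.mem_nhds ht)
  have hA := hd.hasDerivAt.congr_of_eventuallyEq heq
  refine ⟨_, hA, σ.curvature_le t hmem _ hA.hasDerivWithinAt, ?_⟩
  have h1 := hA.norm_sq
  have h2 : HasDerivAt (‖σ.velocity ·‖ ^ 2) 0 t := by
    refine (hasDerivAt_const t (1 : ℝ)).congr_of_eventuallyEq ?_
    filter_upwards [hI] with z hz
    simp [σ.norm_velocity (mem_of_mem_nhds hz)]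
  have := h1.unique h2
  linarith

theorem exists_abs_deriv_inner_le (B : OrthonormalBasis (Fin 2) ℝ Plane) {u v t : ℝ}
    (huv : Icc u v ⊆ Icc 0 σ.len) (hc : ContDiffOn ℝ 2 σ.toFun (Icc u v)) (ht : t ∈ Ioo u v)
    (hκ : 0 ≤ κ) (hB : 0 ≤ ⟪B 0, σ.velocity t⟫) :
    ∃ q, HasDerivAt (fun t => ⟪B 1, σ.velocity t⟫) q t ∧ |q| ≤ κ * ⟪B 0, σ.velocity t⟫ := by
  obtain ⟨A, hA, hAκ, hAv⟩ := σ.exists_hasDerivAt_velocity huv hc ht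
  refine ⟨⟪B 1, A⟫, by simpa using (hasDerivAt_const t (B 1)).inner ℝ hA,
    abs_le_mul_of_orthogonal (b := ⟪B 1, σ.velocity t⟫) (p := ⟪B 0, A⟫) hB hκ ?_ ?_ ?_⟩
  · rw [← B.norm_sq_eq_fin_two, σ.norm_velocity (huv (Ioo_subset_Icc_self ht)), one_pow]
  · rw [← B.inner_eq_fin_two, hAv]
  · rw [← B.norm_sq_eq_fin_two]
    exact pow_le_pow_left₀ (norm_nonneg _) hAκ 2

/-- The acceleration is normal to the velocity `(a, b)`, so its second component is at most `κ * a`,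
which is the derivative of `E / r`. Hence `E / r ± b` increases on each `C²` piece, and continuity
glues the pieces. -/
theorem isForwardProfile (B : OrthonormalBasis (Fin 2) ℝ Plane) {p : Plane} {r δ : ℝ} (hr : 0 < r)
    (hκ : κ = 1 / r) (hx : x = p - δ • B 0) (hy : y = p + δ • B 0)
    (hσ : ∀ t ∈ Icc 0 σ.len, 0 ≤ ⟪B 0, σ.velocity t⟫) :
    IsForwardProfile r δ σ.len (fun t => ⟪B 0, σ.toFun t - p⟫) (fun t => ⟪B 1, σ.toFun t - p⟫)
      (fun t => ⟪B 0, σ.velocity t⟫) (fun t => ⟪B 1, σ.velocity t⟫) := by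
  have hκ0 : 0 ≤ κ := by rw [hκ]; positivity
  obtain ⟨m, t, ht, h0, hm, hc⟩ := σ.piecewiseC2
  have hsub : ∀ i < m, Icc (t i) (t (i + 1)) ⊆ Icc 0 σ.len := fun i hi => by
    rw [← h0, ← hm]
    exact Icc_subset_Icc (ht.monotoneOn (Nat.zero_le m) hi.le i.zero_le)
      (ht.monotoneOn (Nat.succ_le_of_lt hi) (mem_Iic.2 le_rfl) hi)
  have hcE : ContinuousOn (fun t => ⟪B 0, σ.toFun t - p⟫ / r) (Icc 0 σ.len) := fun u hu =>
    ((σ.hasDerivWithinAt_inner (B 0) p hu).div_const r).continuousWithinAt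
  have hcb : ContinuousOn (fun t => ⟪B 1, σ.velocity t⟫) (Icc 0 σ.len) :=
    continuousOn_const.inner σ.continuousOn_velocity
  have hder : ∀ i < m, ∀ u ∈ Ioo (t i) (t (i + 1)),
      HasDerivAt (fun t => ⟪B 0, σ.toFun t - p⟫ / r) (⟪B 0, σ.velocity u⟫ / r) u ∧
      ∃ q, HasDerivAt (fun t => ⟪B 1, σ.velocity t⟫) q u ∧ |q| ≤ ⟪B 0, σ.velocity u⟫ / r := by
    intro i hi u hu
    have hu' := hsub i hi (Ioo_subset_Icc_self hu)
    refine ⟨((σ.hasDerivWithinAt_inner (B 0) p hu').div_const r).hasDerivAt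
      (mem_of_superset (Icc_mem_nhds hu.1 hu.2) (hsub i hi)), ?_⟩
    obtain ⟨q, hq, hq'⟩ := σ.exists_abs_deriv_inner_le B (hsub i hi) (hc i hi) hu hκ0 (hσ u hu')
    exact ⟨q, hq, hq'.trans_eq (by rw [div_eq_inv_mul, ← one_div, ← hκ])⟩
  refine
    { length_nonneg := σ.len_pos.le
      deriv_fst := fun t ht => σ.hasDerivWithinAt_inner _ _ ht
      deriv_snd := fun t ht => σ.hasDerivWithinAt_inner _ _ ht
      unit := fun t ht => by
        rw [← B.norm_sq_eq_fin_two, σ.norm_velocity ht, one_pow]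
      forward := hσ
      mono_add := ?_
      mono_sub := ?_
      fst_zero := by simp [σ.source, hx, inner_smul_right]
      fst_end := by simp [σ.target, hy, inner_smul_right]
      snd_zero := by simp [σ.source, hx, inner_smul_right]
      snd_end := by simp [σ.target, hy, inner_smul_right] }
  · have := monotoneOn_Icc_of_piecewise ht (by rw [h0, hm]; exact hcE.add hcb) fun i hi u hu => by
      obtain ⟨h1, q, h2, h3⟩ := hder i hi u hu
      exact ⟨_, h1.add h2, by linarith [(abs_le.1 h3).1]⟩
    rwa [h0, hm] at this
  · have := monotoneOn_Icc_of_piecewise ht (by rw [h0, hm]; exact hcE.sub hcb) fun i hi u hu => by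
      obtain ⟨h1, q, h2, h3⟩ := hder i hi u hu
      exact ⟨_, h1.sub h2, by linarith [(abs_le.1 h3).2]⟩
    rwa [h0, hm] at this

/-! ### The clopen set of forward curves -/

/-- The curves that always move forward in the direction `e`. -/
def forwardCurves (κ : ℝ) (x y e : Plane) : Set (ConstrainedCurve κ x y) :=
  {σ | ∀ t ∈ Icc 0 σ.len, 0 < ⟪e, σ.velocity t⟫}

theorem inner_rescaledVelocity (e : Plane) (u : unitInterval) :
    ⟪e, σ.rescaledVelocity u⟫ = σ.len * ⟪e, σ.velocity (σ.len * u)⟫ :=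
  inner_smul_right _ _ _

theorem forall_mem_Icc_iff {P : ℝ → Prop} :
    (∀ t ∈ Icc 0 σ.len, P t) ↔ ∀ u : unitInterval, P (σ.len * u) := by
  refine ⟨fun h u => h _ (σ.mul_mem_Icc u), fun h t ht => ?_⟩
  have := h ⟨t / σ.len, div_nonneg ht.1 σ.len_pos.le, div_le_one_of_le₀ ht.2 σ.len_pos.le⟩
  rwa [mul_div_cancel₀ _ σ.len_pos.ne'] at this

theorem continuous_rescaledVelocity :
    Continuous (rescaledVelocity : ConstrainedCurve κ x y → C(unitInterval, Plane)) :=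
  continuous_snd.comp (continuous_induced_dom (f := fun σ : ConstrainedCurve κ x y =>
    (σ.rescaled, σ.rescaledVelocity)))

theorem isOpen_forwardCurves (e : Plane) : IsOpen (forwardCurves κ x y e) := by
  have h1 : IsOpen {v : Plane | 0 < ⟪e, v⟫} :=
    isOpen_lt continuous_const (continuous_const.inner continuous_id)
  have h2 := (ContinuousMap.isOpen_setOfPred_mapsTo (isCompact_univ (X := unitInterval)) h1).preimage
    (continuous_rescaledVelocity (κ := κ) (x := x) (y := y))
  convert h2 using 1
  ext σ
  refine σ.forall_mem_Icc_iff.trans ?_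
  simp [MapsTo, inner_rescaledVelocity, σ.len_pos]

theorem isClosed_setOf_nonneg (e : Plane) :
    IsClosed {σ : ConstrainedCurve κ x y | ∀ t ∈ Icc 0 σ.len, 0 ≤ ⟪e, σ.velocity t⟫} := by
  have h1 : IsClosed {v : Plane | 0 ≤ ⟪e, v⟫} :=
    isClosed_le continuous_const (continuous_const.inner continuous_id)
  have h2 := (ContinuousMap.isClosed_setOfPred_mapsTo h1 (univ : Set unitInterval)).preimage
    (continuous_rescaledVelocity (κ := κ) (x := x) (y := y))
  convert h2 using 1
  ext σ
  refine σ.forall_mem_Icc_iff.trans ?_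
  simp [MapsTo, inner_rescaledVelocity, σ.len_pos]

/-- By rigidity the strict and weak forward conditions define the same set; the first is open and
the second closed. -/
theorem isClopen_forwardCurves (B : OrthonormalBasis (Fin 2) ℝ Plane) {p : Plane} {r δ : ℝ}
    (hκ : κ = 1 / r) (hδ0 : 0 < δ) (hδ : δ < r) (hx : x = p - δ • B 0) (hy : y = p + δ • B 0) :
    IsClopen (forwardCurves κ x y (B 0)) := by
  refine ⟨?_, isOpen_forwardCurves _⟩
  convert isClosed_setOf_nonneg (κ := κ) (x := x) (y := y) (B 0) using 1
  ext σ
  refine ⟨fun h t ht => (h t ht).le, fun h t ht => ?_⟩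
  exact (σ.isForwardProfile B (hδ0.trans hδ) hκ hx hy h).fst_velocity_pos hδ0 hδ ht

theorem Homotopic.mem_forwardCurves {B : OrthonormalBasis (Fin 2) ℝ Plane} {p : Plane} {r δ : ℝ}
    {σ γ : ConstrainedCurve κ x y} (h : σ.Homotopic γ) (hκ : κ = 1 / r) (hδ0 : 0 < δ) (hδ : δ < r)
    (hx : x = p - δ • B 0) (hy : y = p + δ • B 0) (hσ : σ ∈ forwardCurves κ x y (B 0)) :
    γ ∈ forwardCurves κ x y (B 0) :=
  (isClopen_forwardCurves B hκ hδ0 hδ hx hy).connectedComponent_subset hσ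
    (pathComponent_subset_component σ h)

/-- Only `h ^ 2` is prescribed, so both signs of `h` are allowed and the lemma serves both disks. -/
theorem mem_closedBall_of_mem_forwardCurves (B : OrthonormalBasis (Fin 2) ℝ Plane) {p : Plane}
    {r δ h : ℝ} (hκ : κ = 1 / r) (hδ0 : 0 < δ) (hδ : δ < r) (hx : x = p - δ • B 0)
    (hy : y = p + δ • B 0) (hh : h ^ 2 = r ^ 2 - δ ^ 2) {σ : ConstrainedCurve κ x y}
    (hσ : σ ∈ forwardCurves κ x y (B 0)) {t : ℝ} (ht : t ∈ Icc 0 σ.len) :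
    σ.toFun t ∈ Metric.closedBall (p - h • B 1) r := by
  have hr : 0 < r := hδ0.trans hδ
  have H := σ.isForwardProfile B hr hκ hx hy fun t ht => (hσ t ht).le
  have h1 := H.snd_add_le hr hδ ht
  have h2 := H.reflect.snd_add_le hr hδ ht
  have hm := H.fst_mem ht
  rw [← hh, Real.sqrt_sq_eq_abs] at h1 h2
  have h3 := le_abs_self h
  have h4 := neg_abs_le h
  have h5 := Real.sq_sqrt (show 0 ≤ r ^ 2 - ⟪B 0, σ.toFun t - p⟫ ^ 2 by nlinarith [hm.1, hm.2])
  rw [mem_closedBall_iff_norm]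
  refine le_of_sq_le_sq ?_ hr.le
  rw [show σ.toFun t - (p - h • B 1) = σ.toFun t - p + h • B 1 by abel, B.norm_sq_eq_fin_two,
    inner_add_right, inner_add_right, inner_smul_right, inner_smul_right, B.inner_zero_one]
  rw [B.inner_one_one, mul_zero, mul_one, add_zero]
  have h6 : (⟪B 1, σ.toFun t - p⟫ + h) ^ 2 ≤ √(r ^ 2 - ⟪B 0, σ.toFun t - p⟫ ^ 2) ^ 2 := by
    apply sq_le_sq'
    · linarith
    · linarith
  linarith

end ConstrainedCurve

/-! ### Orthonormal frames and circular arcs -/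

theorem exists_orthonormalBasis_fin_two_of_norm_eq_one {e : Plane} (he : ‖e‖ = 1) :
    ∃ B : OrthonormalBasis (Fin 2) ℝ Plane, B 0 = e := by
  have hv : Orthonormal ℝ (({0} : Set (Fin 2)).domRestrict fun _ => e) :=
    ⟨fun _ => he, fun i j hij => absurd (Subsingleton.elim i j) hij⟩
  obtain ⟨B, hB⟩ := hv.exists_orthonormalBasis_extension_of_card_eq (by simp)
  exact ⟨B, hB 0 rfl⟩

theorem exists_orthonormalBasis_fin_two {e n : Plane} (he : ‖e‖ = 1) (hn : ‖n‖ = 1)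
    (hen : ⟪e, n⟫ = 0) : ∃ B : OrthonormalBasis (Fin 2) ℝ Plane, B 0 = e ∧ B 1 = n := by
  have hv : Orthonormal ℝ ![e, n] := by
    rw [orthonormal_iff_ite]
    simp [Fin.forall_fin_two, he, hn, hen, real_inner_comm e n]
  obtain ⟨B, hB⟩ := (hv.comp _ (Subtype.val_injective (p := (· ∈ (univ : Set (Fin 2)))))
    ).exists_orthonormalBasis_extension_of_card_eq (v := ![e, n]) (by simp)
  exact ⟨B, hB 0 trivial, hB 1 trivial⟩

/-- The point with polar angle `ψ`, measured from `B 1` towards `B 0`, on a circle. -/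
noncomputable def circlePoint (B : OrthonormalBasis (Fin 2) ℝ Plane) (c : Plane) (r ψ : ℝ) :
    Plane :=
  c + ((r * Real.sin ψ) • B 0 + (r * Real.cos ψ) • B 1)

section CirclePoint

variable (B : OrthonormalBasis (Fin 2) ℝ Plane) (c : Plane) {r : ℝ} (φ : ℝ)

theorem hasDerivAt_circlePoint (hr : r ≠ 0) (t : ℝ) :
    HasDerivAt (fun t => circlePoint B c r (φ + t / r))
      (Real.cos (φ + t / r) • B 0 - Real.sin (φ + t / r) • B 1) t := by
  have h0 : HasDerivAt (fun t : ℝ => φ + t / r) (1 / r) t :=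
    ((hasDerivAt_id t).div_const r).const_add φ
  have h1 := ((h0.sin.const_mul r).smul_const (B 0)).add ((h0.cos.const_mul r).smul_const (B 1))
  refine (h1.const_add c).congr_deriv ?_
  rw [show r * (Real.cos (φ + t / r) * (1 / r)) = Real.cos (φ + t / r) by field_simp,
    show r * (-Real.sin (φ + t / r) * (1 / r)) = -Real.sin (φ + t / r) by field_simp, neg_smul,
    sub_eq_add_neg]

theorem hasDerivAt_circleTangent (t : ℝ) :
    HasDerivAt (fun t => Real.cos (φ + t / r) • B 0 - Real.sin (φ + t / r) • B 1)
      ((-Real.sin (φ + t / r) * (1 / r)) • B 0 - (Real.cos (φ + t / r) * (1 / r)) • B 1) t := by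
  have h0 : HasDerivAt (fun t : ℝ => φ + t / r) (1 / r) t :=
    ((hasDerivAt_id t).div_const r).const_add φ
  exact (h0.cos.smul_const (B 0)).sub (h0.sin.smul_const (B 1))

theorem contDiff_circlePoint {k : WithTop ℕ∞} :
    ContDiff ℝ k (fun t => circlePoint B c r (φ + t / r)) := by
  unfold circlePoint
  fun_prop

theorem derivWithin_circlePoint (hr : r ≠ 0) {L t : ℝ} (hL : 0 < L) (ht : t ∈ Icc 0 L) :
    derivWithin (fun t => circlePoint B c r (φ + t / r)) (Icc 0 L) t =
      Real.cos (φ + t / r) • B 0 - Real.sin (φ + t / r) • B 1 :=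
  (hasDerivAt_circlePoint B c φ hr t).hasDerivWithinAt.derivWithin (uniqueDiffOn_Icc hL t ht)

theorem norm_smul_sub_smul (u v : ℝ) : ‖u • B 0 - v • B 1‖ ^ 2 = u ^ 2 + v ^ 2 := by
  rw [B.norm_sq_eq_fin_two]
  simp [inner_sub_right, inner_smul_right]

theorem dist_circlePoint (hr : 0 ≤ r) (ψ : ℝ) : dist (circlePoint B c r ψ) c = r := by
  have := norm_smul_sub_smul B (r * Real.sin ψ) (-(r * Real.cos ψ))
  rw [neg_smul, sub_neg_eq_add] at this
  rw [dist_eq_norm, circlePoint, add_sub_cancel_left, ← sq_eq_sq₀ (norm_nonneg _) hr, this]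
  linear_combination r ^ 2 * Real.sin_sq_add_cos_sq ψ

/-- The circular arc of length `L` starting at the point with polar angle `φ`. -/
noncomputable def ConstrainedCurve.circularArc {κ L : ℝ} {x y : Plane} (hr : 0 < r)
    (hκ : κ = 1 / r) (hL : 0 < L) (hx : circlePoint B c r φ = x)
    (hy : circlePoint B c r (φ + L / r) = y) : ConstrainedCurve κ x y where
  len := L
  toFun t := circlePoint B c r (φ + t / r)
  len_pos := hL
  contDiffOn := (contDiff_circlePoint B c φ).contDiffOn
  piecewiseC2 := by
    refine ⟨1, fun i => i * L, fun i _ j _ hij => ?_, by simp, by simp,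
      fun i _ => (contDiff_circlePoint B c φ).contDiffOn⟩
    exact mul_lt_mul_of_pos_right (Nat.cast_lt.2 hij) hL
  unit_speed t ht := by
    rw [derivWithin_circlePoint B c φ hr.ne' hL ht, ← sq_eq_sq₀ (norm_nonneg _) zero_le_one,
      norm_smul_sub_smul, Real.cos_sq_add_sin_sq, one_pow]
  curvature_le t ht a ha := by
    have h1 := ha.congr (fun u hu => (derivWithin_circlePoint B c φ hr.ne' hL hu).symm)
      (derivWithin_circlePoint B c φ hr.ne' hL ht).symm
    have h2 := (uniqueDiffOn_Icc hL t ht).eq_deriv _ h1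
      (hasDerivAt_circleTangent B (r := r) φ t).hasDerivWithinAt
    refine le_of_sq_le_sq (le_of_eq ?_) (hκ ▸ (one_div_pos.2 hr).le)
    rw [h2, norm_smul_sub_smul, hκ]
    linear_combination (1 / r) ^ 2 * Real.sin_sq_add_cos_sq (φ + t / r)
  source := by simpa using hx
  target := hy

end CirclePoint

/-! ### The arcs cut off by the chord -/

section Chord

variable {B : OrthonormalBasis (Fin 2) ℝ Plane} {c x y : Plane} {r δ h : ℝ}

theorem sin_arcsin_div (hδ : 0 < δ) (hr : 0 < r) (hrh : r ^ 2 = δ ^ 2 + h ^ 2) :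
    r * Real.sin (Real.arcsin (δ / r)) = δ := by
  have : δ ≤ r := le_of_sq_le_sq (by nlinarith) hr.le
  have h0 : 0 < δ / r := div_pos hδ hr
  rw [Real.sin_arcsin (by linarith) ((div_le_one hr).2 this), mul_div_cancel₀ _ hr.ne']

theorem cos_arcsin_div (hh : 0 ≤ h) (hr : 0 < r) (hrh : r ^ 2 = δ ^ 2 + h ^ 2) :
    r * Real.cos (Real.arcsin (δ / r)) = h := by
  rw [Real.cos_arcsin, show 1 - (δ / r) ^ 2 = (h / r) ^ 2 by field_simp; linarith,
    Real.sqrt_sq (div_nonneg hh hr.le), mul_div_cancel₀ _ hr.ne']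

theorem circlePoint_arcsin (hδ : 0 < δ) (hh : 0 < h) (hr : 0 < r) (hrh : r ^ 2 = δ ^ 2 + h ^ 2) :
    circlePoint B c r (Real.arcsin (δ / r)) = c + (δ • B 0 + h • B 1) := by
  rw [circlePoint, sin_arcsin_div hδ hr hrh, cos_arcsin_div hh.le hr hrh]

theorem circlePoint_neg_arcsin (hδ : 0 < δ) (hh : 0 < h) (hr : 0 < r)
    (hrh : r ^ 2 = δ ^ 2 + h ^ 2) :
    circlePoint B c r (-Real.arcsin (δ / r)) = c + (-δ • B 0 + h • B 1) := by
  rw [circlePoint, Real.sin_neg, Real.cos_neg, mul_neg, sin_arcsin_div hδ hr hrh,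
    cos_arcsin_div hh.le hr hrh]

theorem inner_of_sub_eq_smul_add {z : Plane} {a b : ℝ} (hx : x = c + (-δ • B 0 + h • B 1))
    (hy : y = c + (δ • B 0 + h • B 1)) (hz : z - c = a • (x - c) + b • (y - c)) :
    ⟪B 0, z - c⟫ = (b - a) * δ ∧ ⟪B 1, z - c⟫ = (a + b) * h := by
  rw [hz, hx, hy]
  simp only [add_sub_cancel_left, inner_add_right, inner_smul_right, B.inner_zero_zero,
    B.inner_zero_one, B.inner_one_zero, B.inner_one_one]
  constructor <;> ring

theorem norm_sub_sq_of_mem_sphere {z : Plane} (hz : z ∈ Metric.sphere c r) :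
    ⟪B 0, z - c⟫ ^ 2 + ⟪B 1, z - c⟫ ^ 2 = r ^ 2 := by
  rw [← B.norm_sq_eq_fin_two, mem_sphere_iff_norm.1 hz]

theorem inner_pos_of_mem_shorterArc (hh : 0 < h) (hr : 0 < r)
    (hx : x = c + (-δ • B 0 + h • B 1)) (hy : y = c + (δ • B 0 + h • B 1)) {z : Plane}
    (hz : z ∈ shorterArc r c x y) : 0 < ⟪B 1, z - c⟫ := by
  obtain ⟨hs, a, b, ha, hb, hab⟩ := hz
  obtain ⟨h0, h1⟩ := inner_of_sub_eq_smul_add hx hy hab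
  have h2 := norm_sub_sq_of_mem_sphere (B := B) hs
  rw [h1]
  refine mul_pos ((add_nonneg ha hb).lt_of_ne' fun h3 => ?_) hh
  obtain ⟨rfl, rfl⟩ := (add_eq_zero_iff_of_nonneg ha hb).1 h3
  simp only [h0, h1] at h2
  nlinarith [pow_pos hr 2]

theorem image_circlePoint_eq_shorterArc (hδ : 0 < δ) (hh : 0 < h) (hr : 0 < r)
    (hrh : r ^ 2 = δ ^ 2 + h ^ 2) (hx : x = c + (-δ • B 0 + h • B 1))
    (hy : y = c + (δ • B 0 + h • B 1)) :
    circlePoint B c r '' Icc (-Real.arcsin (δ / r)) (Real.arcsin (δ / r)) =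
      shorterArc r c x y := by
  have hsin := sin_arcsin_div hδ hr hrh
  have hcos := cos_arcsin_div hh.le hr hrh
  have hδr : 0 < δ / r := div_pos hδ hr
  have hα := Real.arcsin_le_pi_div_two (δ / r)
  apply Subset.antisymm
  · rintro _ ⟨ψ, hψ, rfl⟩
    -- These coefficients solve `(b - a) * δ = r * sin ψ` and `(a + b) * h = r * cos ψ`.
    refine ⟨dist_circlePoint B c hr.le ψ, r ^ 2 * Real.sin (Real.arcsin (δ / r) - ψ) / (2 * δ * h),
      r ^ 2 * Real.sin (Real.arcsin (δ / r) + ψ) / (2 * δ * h), ?_, ?_, ?_⟩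
    · have := Real.sin_nonneg_of_nonneg_of_le_pi (x := Real.arcsin (δ / r) - ψ)
        (by linarith [hψ.2]) (by linarith [hψ.1])
      positivity
    · have := Real.sin_nonneg_of_nonneg_of_le_pi (x := Real.arcsin (δ / r) + ψ)
        (by linarith [hψ.1]) (by linarith [hψ.2])
      positivity
    · have e1 : r ^ 2 * Real.sin (Real.arcsin (δ / r) - ψ) =
          r * (δ * Real.cos ψ - h * Real.sin ψ) := by
        rw [Real.sin_sub]
        linear_combination r * Real.cos ψ * hsin - r * Real.sin ψ * hcos
      have e2 : r ^ 2 * Real.sin (Real.arcsin (δ / r) + ψ) =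
          r * (δ * Real.cos ψ + h * Real.sin ψ) := by
        rw [Real.sin_add]
        linear_combination r * Real.cos ψ * hsin + r * Real.sin ψ * hcos
      rw [e1, e2, hx, hy, circlePoint]
      apply OrthonormalBasis.eq_of_inner_eq (B := B) <;>
      · simp only [add_sub_cancel_left, inner_add_right, inner_smul_right, B.inner_zero_zero,
          B.inner_zero_one, B.inner_one_zero, B.inner_one_one]
        field_simp
        ring
  · rintro z ⟨hs, a, b, ha, hb, hab⟩
    obtain ⟨h0, h1⟩ := inner_of_sub_eq_smul_add hx hy hab
    have h2 := norm_sub_sq_of_mem_sphere (B := B) hs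
    -- Since `a, b ≥ 0`, `(a + b) ^ 2` dominates `(b - a) ^ 2`; if the latter exceeded `1`, the
    -- point would be farther than `r` from `c`.
    have hba : (b - a) ^ 2 ≤ 1 ^ 2 := by
      by_contra! hlt
      have : (b - a) ^ 2 ≤ (a + b) ^ 2 := by nlinarith [mul_nonneg ha hb]
      rw [h0, h1, mul_pow, mul_pow, hrh] at h2
      nlinarith [mul_pos (sub_pos.2 hlt) (pow_pos hδ 2),
        mul_pos (sub_pos.2 (hlt.trans_le this)) (pow_pos hh 2)]
    obtain ⟨hl, hu⟩ := abs_le_of_sq_le_sq' hba zero_le_one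
    have hle : (b - a) * δ ≤ δ := by nlinarith
    have hge : -δ ≤ (b - a) * δ := by nlinarith
    have hCh : 0 ≤ (a + b) * h := by positivity
    rw [h0, h1] at h2
    have hS : (b - a) * δ ≤ r := le_of_sq_le_sq (by nlinarith [sq_nonneg ((a + b) * h)]) hr.le
    have hS' : -((b - a) * δ) ≤ r := le_of_sq_le_sq (by nlinarith [sq_nonneg ((a + b) * h)]) hr.le
    refine ⟨Real.arcsin ((b - a) * δ / r), ⟨?_, ?_⟩, ?_⟩
    · rw [← Real.arcsin_neg, ← neg_div]
      exact Real.monotone_arcsin (div_le_div_of_nonneg_right hge hr.le)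
    · exact Real.monotone_arcsin (div_le_div_of_nonneg_right hle hr.le)
    · rw [circlePoint, cos_arcsin_div hCh hr h2.symm, Real.sin_arcsin
        (by rw [le_div_iff₀ hr]; linarith) ((div_le_one hr).2 hS), mul_div_cancel₀ _ hr.ne',
        ← h0, ← h1]
      have := B.sum_repr' (z - c)
      rw [Fin.sum_univ_two] at this
      rw [this]
      abel

theorem exists_curve_image_eq_shorterArc {κ : ℝ} (hκ : κ = 1 / r) (hδ : 0 < δ) (hh : 0 < h)
    (hr : 0 < r) (hrh : r ^ 2 = δ ^ 2 + h ^ 2) (hx : x = c + (-δ • B 0 + h • B 1))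
    (hy : y = c + (δ • B 0 + h • B 1)) :
    ∃ σ : ConstrainedCurve κ x y, σ.image = shorterArc r c x y := by
  have hα : 0 < Real.arcsin (δ / r) := Real.arcsin_pos.2 (div_pos hδ hr)
  set α := Real.arcsin (δ / r) with hα_def
  refine ⟨ConstrainedCurve.circularArc B c (-α) (L := 2 * α * r) hr hκ (by positivity) ?_ ?_, ?_⟩
  · rw [hα_def, circlePoint_neg_arcsin hδ hh hr hrh, hx]
  · rw [mul_div_cancel_right₀ _ hr.ne', show -α + 2 * α = α by ring, hα_def,
      circlePoint_arcsin hδ hh hr hrh, hy]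
  · rw [← image_circlePoint_eq_shorterArc hδ hh hr hrh hx hy]
    change _ = circlePoint B c r '' Icc (-α) α
    apply Subset.antisymm
    · rintro _ ⟨t, ht, rfl⟩
      refine ⟨-α + t / r, ⟨?_, ?_⟩, rfl⟩
      · linarith [div_nonneg ht.1 hr.le]
      · have : t / r ≤ 2 * α := (div_le_iff₀ hr).2 ht.2
        linarith
    · rintro _ ⟨ψ, hψ, rfl⟩
      refine ⟨(ψ + α) * r, ⟨mul_nonneg (by linarith [hψ.1]) hr.le, ?_⟩, ?_⟩
      · exact mul_le_mul_of_nonneg_right (by linarith [hψ.2]) hr.le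
      · change circlePoint B c r (-α + (ψ + α) * r / r) = _
        rw [mul_div_cancel_right₀ _ hr.ne']
        congr 1
        ring

theorem exists_curve_notMem_forwardCurves {κ : ℝ} (hκ : κ = 1 / r) (hδ : 0 < δ) (hh : 0 < h)
    (hr : 0 < r) (hrh : r ^ 2 = δ ^ 2 + h ^ 2) (hx : x = c + (-δ • B 0 + h • B 1))
    (hy : y = c + (δ • B 0 + h • B 1)) :
    ∃ σ : ConstrainedCurve κ x y, σ ∉ ConstrainedCurve.forwardCurves κ x y (B 0) := by
  -- Reversing `B 0` reverses the direction of travel, so the arc from angle `α` of length `(2π -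
  -- 2α) r` is the longer one from `x` to `y`. Its initial velocity has `B 0`-component `-cos α <
  -- 0`.
  obtain ⟨B', h0, h1⟩ := exists_orthonormalBasis_fin_two (e := -B 0) (n := B 1) (by simp)
    (by simp) (by simp)
  have hα := Real.arcsin_le_pi_div_two (δ / r)
  have hcos := cos_arcsin_div hh.le hr hrh
  set α := Real.arcsin (δ / r) with hα_def
  have hL : 0 < (2 * Real.pi - 2 * α) * r :=
    mul_pos (by linarith [Real.pi_pos]) hr
  refine ⟨ConstrainedCurve.circularArc B' c α (L := (2 * Real.pi - 2 * α) * r) hr hκ hL ?_ ?_,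
    fun hf => ?_⟩
  · rw [hα_def, circlePoint_arcsin hδ hh hr hrh, hx, h0, h1, smul_neg, neg_smul]
  · rw [mul_div_cancel_right₀ _ hr.ne', show α + (2 * Real.pi - 2 * α) = -α + 2 * Real.pi by ring,
      circlePoint, Real.sin_add_two_pi, Real.cos_add_two_pi, ← circlePoint, hα_def,
      circlePoint_neg_arcsin hδ hh hr hrh, hy, h0, h1, smul_neg, neg_smul, neg_neg]
  · have h2 := hf 0 ⟨le_rfl, hL.le⟩
    have h3 := derivWithin_circlePoint B' c α hr.ne' hL ⟨le_rfl, hL.le⟩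
    replace h2 := h2.trans_eq (congrArg (fun v => ⟪B 0, v⟫) h3)
    simp only [zero_div, add_zero, h0, h1, inner_sub_right, inner_smul_right, inner_neg_right,
      B.inner_zero_zero, B.inner_zero_one] at h2
    nlinarith

/-- On the upper open half of a circle no tangent is parallel to `B 1`, so the `B 0`-component of
the velocity never vanishes. By continuity it has constant sign, and the endpoints decide which.
Only the image matters, not the parametrisation. -/
theorem mem_forwardCurves_of_image_subset {κ : ℝ} (hxy : ⟪B 0, x - c⟫ < ⟪B 0, y - c⟫)
    {σ : ConstrainedCurve κ x y}
    (hσ : ∀ z ∈ σ.image, z ∈ Metric.sphere c r ∧ 0 < ⟪B 1, z - c⟫) :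
    σ ∈ ConstrainedCurve.forwardCurves κ x y (B 0) := by
  have hmem : ∀ t ∈ Icc 0 σ.len, σ.toFun t ∈ σ.image := fun t ht => mem_image_of_mem _ ht
  have hne : ∀ t ∈ Icc 0 σ.len, ⟪B 0, σ.velocity t⟫ ≠ 0 := by
    intro t ht h0
    have h1 := ((σ.hasDerivWithinAt ht).sub_const c).norm_sq
    have h2 : HasDerivWithinAt (fun t => ‖σ.toFun t - c‖ ^ 2) 0 (Icc 0 σ.len) t := by
      have heq : ∀ u ∈ Icc 0 σ.len, ‖σ.toFun u - c‖ ^ 2 = r ^ 2 := fun u hu => by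
        rw [mem_sphere_iff_norm.1 (hσ _ (hmem u hu)).1]
      exact (hasDerivWithinAt_const t _ (r ^ 2)).congr heq (heq t ht)
    have h3 := (uniqueDiffOn_Icc σ.len_pos t ht).eq_deriv _ h1 h2
    have h4 := B.norm_sq_eq_fin_two (σ.velocity t)
    rw [B.inner_eq_fin_two, h0, mul_zero, zero_add] at h3
    have h5 := (hσ _ (hmem t ht)).2
    have h6 : ⟪B 1, σ.velocity t⟫ = 0 := by
      rcases mul_eq_zero.1 ((mul_eq_zero.1 h3).resolve_left two_ne_zero) with h | h
      · exact absurd h h5.ne'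
      · exact h
    rw [h0, h6, σ.norm_velocity ht] at h4
    norm_num at h4
  have hcont : ContinuousOn (fun t => ⟪B 0, σ.velocity t⟫) (Icc 0 σ.len) :=
    continuousOn_const.inner σ.continuousOn_velocity
  intro t ht
  by_contra! hneg
  have hall : ∀ u ∈ Icc 0 σ.len, ⟪B 0, σ.velocity u⟫ ≤ 0 := by
    intro u hu
    by_contra! hpos
    obtain ⟨w, hw, hw0⟩ := isPreconnected_Icc.intermediate_value ht hu hcont ⟨hneg, hpos.le⟩
    exact hne w hw hw0
  have hanti : AntitoneOn (fun t => ⟪B 0, σ.toFun t - c⟫) (Icc 0 σ.len) :=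
    antitoneOn_of_hasDerivWithinAt_nonpos (convex_Icc _ _)
      (fun u hu => (σ.hasDerivWithinAt_inner (B 0) c hu).continuousWithinAt)
      (fun u hu => (σ.hasDerivWithinAt_inner (B 0) c (interior_subset hu)).mono interior_subset)
      fun u hu => hall u (interior_subset hu)
  have := hanti ⟨le_rfl, σ.len_pos.le⟩ ⟨σ.len_pos.le, le_rfl⟩ σ.len_pos.le
  simp only [σ.source, σ.target] at this
  linarith

theorem mem_forwardCurves_of_image_eq_shorterArc {κ : ℝ} (hδ : 0 < δ) (hh : 0 < h) (hr : 0 < r)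
    (hx : x = c + (-δ • B 0 + h • B 1)) (hy : y = c + (δ • B 0 + h • B 1))
    {σ : ConstrainedCurve κ x y} (hσ : σ.image = shorterArc r c x y) :
    σ ∈ ConstrainedCurve.forwardCurves κ x y (B 0) := by
  refine mem_forwardCurves_of_image_subset (c := c) (r := r) ?_ fun z hz => ?_
  · rw [hx, hy]
    simp only [add_sub_cancel_left, inner_add_right, inner_smul_right, B.inner_zero_zero,
      B.inner_zero_one]
    linarith
  · rw [hσ] at hz
    exact ⟨hz.1, inner_pos_of_mem_shorterArc hh hr hx hy hz⟩

/-- A centre equidistant from `x` and `y` lies on the perpendicular bisector of the chord. -/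
theorem exists_center_eq_add_smul {p : Plane} (hδ : 0 < δ) (hx : x = p - δ • B 0)
    (hy : y = p + δ • B 0) (hxc : x ∈ Metric.sphere c r) (hyc : y ∈ Metric.sphere c r) :
    ∃ l : ℝ, c = p + l • B 1 ∧ r ^ 2 = δ ^ 2 + l ^ 2 := by
  have h1 := norm_sub_sq_of_mem_sphere (B := B) hxc
  have h2 := norm_sub_sq_of_mem_sphere (B := B) hyc
  rw [show x - c = -(δ • B 0) - (c - p) by rw [hx]; abel] at h1
  rw [show y - c = δ • B 0 - (c - p) by rw [hy]; abel] at h2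
  rw [← sub_add_cancel c p, add_comm]
  generalize c - p = w at h1 h2
  simp only [inner_sub_right, inner_neg_right, inner_smul_right, B.inner_zero_zero,
    B.inner_one_zero] at h1 h2
  have hu : ⟪B 0, w⟫ = 0 := by
    have : δ * ⟪B 0, w⟫ = 0 := by linear_combination (h1 - h2) / 4
    exact (mul_eq_zero.1 this).resolve_left hδ.ne'
  refine ⟨⟪B 1, w⟫, ?_, by rw [hu] at h1; linear_combination -h1⟩
  congr 1
  apply OrthonormalBasis.eq_of_inner_eq (B := B)
  · rw [hu, inner_smul_right, B.inner_zero_one, mul_zero]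
  · rw [inner_smul_right, B.inner_one_one, mul_one]

/-- If the circles coincided, the antipode of `x` would be `x` or `y`, contradicting `d < 2r`. -/
theorem centers_ne_of_sphere_inter_eq_pair {c₁ c₂ : Plane} (hr : 0 < r) (hd_lt : dist x y < 2 * r)
    (hC : Metric.sphere c₁ r ∩ Metric.sphere c₂ r = {x, y}) : c₁ ≠ c₂ := by
  rintro rfl
  rw [inter_self] at hC
  have hx : x ∈ Metric.sphere c₁ r := hC ▸ mem_insert x _
  have hx' := mem_sphere_iff_norm.1 hx
  have hz : c₁ - (x - c₁) ∈ Metric.sphere c₁ r := by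
    rwa [mem_sphere_iff_norm, sub_sub_cancel_left, norm_neg]
  have hdist : dist x (c₁ - (x - c₁)) = 2 * r := by
    rw [dist_eq_norm, show x - (c₁ - (x - c₁)) = (2 : ℝ) • (x - c₁) by module, norm_smul, hx']
    norm_num
  rw [hC] at hz
  rcases hz with hz | hz <;> rw [hz] at hdist
  · rw [dist_self] at hdist
    linarith
  · exact hd_lt.ne hdist

theorem exists_chord_frame {c₁ c₂ : Plane} (hr : 0 < r) (hd_pos : 0 < dist x y)
    (hd_lt : dist x y < 2 * r) (hC : Metric.sphere c₁ r ∩ Metric.sphere c₂ r = {x, y}) :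
    ∃ (B : OrthonormalBasis (Fin 2) ℝ Plane) (p : Plane) (δ h : ℝ), 0 < δ ∧ δ < r ∧ 0 < h ∧
      r ^ 2 = δ ^ 2 + h ^ 2 ∧ x = p - δ • B 0 ∧ y = p + δ • B 0 ∧
      c₁ = p - h • B 1 ∧ c₂ = p + h • B 1 := by
  have hmem : ∀ z ∈ ({x, y} : Set Plane), z ∈ Metric.sphere c₁ r ∧ z ∈ Metric.sphere c₂ r :=
    fun z hz => by rwa [← mem_inter_iff, hC]
  obtain ⟨hx₁, hx₂⟩ := hmem x (by simp)
  obtain ⟨hy₁, hy₂⟩ := hmem y (by simp)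
  have he : ‖(dist x y)⁻¹ • (y - x)‖ = 1 := by
    rw [norm_smul, norm_inv, Real.norm_of_nonneg dist_nonneg, ← dist_eq_norm, dist_comm y x,
      inv_mul_cancel₀ hd_pos.ne']
  obtain ⟨B, hB⟩ := exists_orthonormalBasis_fin_two_of_norm_eq_one he
  have hδ : 0 < dist x y / 2 := half_pos hd_pos
  have hδB : (dist x y / 2) • B 0 = (2⁻¹ : ℝ) • (y - x) := by
    rw [hB, smul_smul]
    congr 1
    field_simp
  have hx : x = (2⁻¹ : ℝ) • (x + y) - (dist x y / 2) • B 0 := by rw [hδB]; module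
  have hy : y = (2⁻¹ : ℝ) • (x + y) + (dist x y / 2) • B 0 := by rw [hδB]; module
  obtain ⟨l₁, hc₁, hl₁⟩ := exists_center_eq_add_smul hδ hx hy hx₁ hy₁
  obtain ⟨l₂, hc₂, hl₂⟩ := exists_center_eq_add_smul hδ hx hy hx₂ hy₂
  -- Both offsets have the same square, and equal offsets would give equal centres.
  have hl : l₂ = -l₁ := by
    refine (sq_eq_sq_iff_eq_or_eq_neg.1 (by linarith)).resolve_left fun h => ?_
    exact centers_ne_of_sphere_inter_eq_pair hr hd_lt hC (by rw [hc₁, hc₂, h])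
  have hl0 : l₁ ≠ 0 := by
    rintro rfl
    nlinarith
  -- The sign of `B 1` is chosen so that `c₁` lies on the negative side of the chord.
  rcases hl0.lt_or_gt with hneg | hpos
  · exact ⟨B, _, _, -l₁, hδ, by linarith, by linarith, by rw [hl₁, neg_sq], hx, hy,
      by rw [neg_smul, sub_neg_eq_add]; exact hc₁, by rw [← hl]; exact hc₂⟩
  · obtain ⟨B', hB0, hB1⟩ := exists_orthonormalBasis_fin_two (e := B 0) (n := -B 1) (by simp)
      (by simp) (by simp)
    exact ⟨B', _, _, l₁, hδ, by linarith, hpos, hl₁, hB0 ▸ hx, hB0 ▸ hy,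
      by rw [hB1, smul_neg, sub_neg_eq_add]; exact hc₁,
      by rw [hB1, smul_neg, ← neg_smul, ← hl]; exact hc₂⟩

end Chord

/-! ### The lens and the conclusion -/

/-- A convex set with nonempty interior lies in the closure of its interior; `p` witnesses
nonemptiness. -/
theorem closedBall_inter_subset_closure_lens {c₁ c₂ p : Plane} {r : ℝ} (h₁ : dist p c₁ < r)
    (h₂ : dist p c₂ < r) :
    Metric.closedBall c₁ r ∩ Metric.closedBall c₂ r ⊆ closure (lens r c₁ c₂) := by
  have hconv : Convex ℝ (Metric.closedBall c₁ r ∩ Metric.closedBall c₂ r) :=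
    (convex_closedBall _ _).inter (convex_closedBall _ _)
  have hne : (interior (Metric.closedBall c₁ r ∩ Metric.closedBall c₂ r)).Nonempty := by
    refine ⟨p, ?_⟩
    rw [interior_inter]
    exact ⟨Metric.ball_subset_interior_closedBall h₁, Metric.ball_subset_interior_closedBall h₂⟩
  rw [lens, hconv.closure_interior_eq_closure_of_nonempty_interior hne]
  exact subset_closure

theorem mainTheorem8 (κ r : ℝ) (hκ : 0 < κ) (hr : r = 1 / κ) (x y : Plane)
    (hd_pos : 0 < dist x y) (hd_lt : dist x y < 2 * r) (c₁ c₂ : Plane)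
    (hC : Metric.sphere c₁ r ∩ Metric.sphere c₂ r = {x, y}) :
    ((∃ σ : ConstrainedCurve κ x y, σ.image = shorterArc r c₁ x y) ∧
      (∃ σ : ConstrainedCurve κ x y, σ.image = shorterArc r c₂ x y)) ∧
    (∀ σ γ : ConstrainedCurve κ x y,
      (σ.image = shorterArc r c₁ x y ∨ σ.image = shorterArc r c₂ x y) →
      γ.IsNotIn (closure (lens r c₁ c₂)) → ¬ σ.Homotopic γ) ∧
    2 ≤ Cardinal.mk (HomotopyClasses κ x y) := by
  have hr0 : 0 < r := hr ▸ one_div_pos.2 hκ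
  have hκr : κ = 1 / r := by rw [hr, one_div_one_div]
  obtain ⟨B, p, δ, h, hδ, hδr, hh, hrh, hx, hy, hc₁, hc₂⟩ :=
    exists_chord_frame hr0 hd_pos hd_lt hC
  -- Flipping `B 1` puts `c₂` in the position of `c₁`, while keeping `B 0` leaves the set of forward
  -- curves unchanged.
  obtain ⟨B', hB0, hB1⟩ := exists_orthonormalBasis_fin_two (e := B 0) (n := -B 1) (by simp)
    (by simp) (by simp)
  have hx₁ : x = c₁ + (-δ • B 0 + h • B 1) := by rw [hx, hc₁]; module
  have hy₁ : y = c₁ + (δ • B 0 + h • B 1) := by rw [hy, hc₁]; module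
  have hx₂ : x = c₂ + (-δ • B' 0 + h • B' 1) := by rw [hx, hc₂, hB0, hB1]; module
  have hy₂ : y = c₂ + (δ • B' 0 + h • B' 1) := by rw [hy, hc₂, hB0, hB1]; module
  have hforward : ∀ σ : ConstrainedCurve κ x y,
      (σ.image = shorterArc r c₁ x y ∨ σ.image = shorterArc r c₂ x y) →
      σ ∈ ConstrainedCurve.forwardCurves κ x y (B 0) := by
    rintro σ (hσ | hσ)
    · exact mem_forwardCurves_of_image_eq_shorterArc hδ hh hr0 hx₁ hy₁ hσ
    · exact hB0 ▸ mem_forwardCurves_of_image_eq_shorterArc hδ hh hr0 hx₂ hy₂ hσ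
  have hex₁ := exists_curve_image_eq_shorterArc hκr hδ hh hr0 hrh hx₁ hy₁
  refine ⟨⟨hex₁, exists_curve_image_eq_shorterArc hκr hδ hh hr0 hrh hx₂ hy₂⟩, ?_, ?_⟩
  · rintro σ γ hσ ⟨t, ht, hγ⟩ hhom
    have hγ' := hhom.mem_forwardCurves hκr hδ hδr hx hy (hforward σ hσ)
    have hhr : h < r := lt_of_pow_lt_pow_left₀ 2 hr0.le (by nlinarith)
    refine hγ (closedBall_inter_subset_closure_lens (p := p) ?_ ?_ ⟨?_, ?_⟩)
    · simpa [hc₁, dist_eq_norm, norm_smul, abs_of_pos hh] using hhr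
    · simpa [hc₂, dist_eq_norm, norm_smul, abs_of_pos hh] using hhr
    · rw [hc₁]
      exact ConstrainedCurve.mem_closedBall_of_mem_forwardCurves B hκr hδ hδr hx hy
        (by linarith) hγ' ht
    -- The second disk is the case of offset `-h`.
    · rw [hc₂, ← sub_neg_eq_add, ← neg_smul]
      exact ConstrainedCurve.mem_closedBall_of_mem_forwardCurves B hκr hδ hδr hx hy
        (by linarith [neg_sq h]) hγ' ht
  · obtain ⟨σ, hσ⟩ := hex₁
    obtain ⟨γ, hγ⟩ := exists_curve_notMem_forwardCurves hκr hδ hh hr0 hrh hx₁ hy₁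
    refine Cardinal.two_le_iff.2 ⟨ZerothHomotopy.mk σ, ZerothHomotopy.mk γ, fun heq => hγ ?_⟩
    have hhom : σ.Homotopic γ := Quotient.exact heq
    exact hhom.mem_forwardCurves hκr hδ hδr hx hy (hforward σ (Or.inl hσ))
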